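/- Let $S\subseteq\mathbb R$ be a measurable state space, let $f$ be a probability density on $\mathbb R$ carried by $S$, and write $f(\mathrm dy)=f(y)\,\mathrm dy$. Let $P$ be a Markov transition kernel on $S$ such that (a) $P$ is geometrically ergodic with limit $f$: there are a finite function $M$ on $S$ and a $t\in(0,1)$ with $\sup_{A}|P^n(y,A)-f(A)|\le M(y)\,t^n$ for all $n\ge 0$ and $f$-almost every $y\in S$ (supremum over measurable $A\subseteq S$); (b) $P$ satisfies detailed balance with respect to $f$: $f(\mathrm dy)P(y,\mathrm dy')=f(\mathrm dy')P(y',\mathrm dy)$. Let $Y_1,Y_2,\dots$ be a stationary Markov chain with transition kernel $P$ and $Y_1\sim f$. Let $K$ be a symmetric probability density on $\mathbb R$ with $\int K^2(u)\,\mathrm du<\infty$, let $K_h(u)=K(u/h)/h$, and let $h=h(n)>0$ be any sequence of bandwidths. Define the integrated autocorrelation time of the kernel by $$\tau_n(K_{h,x})=\sum_{t=-(n-1)}^{n-1}\Bigl(1-\frac{|t|}{n}\Bigr)\,\mathrm{corr}\bigl\{K_h(x-Y_1),K_h(x-Y_{|t|+1})\bigr\},$$ where the correlation is read as $0$ if $K_h(x-Y_1)$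 has variance $0$. Then for Lebesgue-almost every $x\in\mathbb R$, the variables $K_{h(n)}(x-Y_i)$ are square-integrable for all $n$ and $i$, and $\tau_n(K_{h(n),x})=O(1)$ as $n\to\infty$. -/

import Mathlib

open MeasureTheory ProbabilityTheory Filter Asymptotics

noncomputable section

/-- `f` is a probability density (with respect to Lebesgue measure) carried by the set `S ⊆ ℝ`. -/
structure IsProbDensityOn (S : Set ℝ) (f : ℝ → ℝ) : Prop where
  measurable : Measurable f
  nonneg : ∀ y, 0 ≤ f y
  eq_zero_of_notMem : ∀ y, y ∉ S → f y = 0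
  integrable : Integrable f volume
  integral_eq_one : ∫ y, f y = 1

/-- The distribution `f(dy) = f(y) dy`, as a measure on the state space `S`. -/
def densityMeasure (S : Set ℝ) (f : ℝ → ℝ) : Measure S :=
  (volume.withDensity fun y => ENNReal.ofReal (f y)).comap ((↑) : S → ℝ)

/-- A (square-integrable) smoothing kernel: a symmetric probability density `K` on `ℝ` for which
`R(K) = ∫ K(u)² du` is finite. -/
structure IsSmoothingKernel (K : ℝ → ℝ) : Prop where
  measurable : Measurable K
  nonneg : ∀ u, 0 ≤ K u
  symmetric : ∀ u, K (-u) = K u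
  integrable : Integrable K volume
  integral_eq_one : ∫ u, K u = 1
  sq_integrable : Integrable (fun u => K u ^ 2) volume

/-- The rescaled kernel `K_h(u) = K(u / h) / h`. -/
def scaledKernel (K : ℝ → ℝ) (h u : ℝ) : ℝ := K (u / h) / h

/-- Total variation distance `sup_A |μ(A) - ν(A)|`, the supremum being over measurable sets. -/
def tvDist {S : Type*} [MeasurableSpace S] (μ ν : Measure S) : ℝ :=
  ⨆ A : {A : Set S // MeasurableSet A}, |μ.real A.1 - ν.real A.1|

/-- Geometric ergodicity of a transition kernel `P` with limit distribution `π`: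
`‖Pⁿ(y, ·) - π‖ ≤ M(y) tⁿ` for all `n`, for some rate `t < 1` and some finite function `M`.
The bound is only asked for `π`-almost every starting point `y`. -/
def IsGeometricallyErgodic {S : Type*} [MeasurableSpace S] (P : Kernel S S) (π : Measure S) :
    Prop :=
  ∃ (M : S → ℝ) (t : ℝ), 0 < t ∧ t < 1 ∧
    ∀ᵐ y ∂π, ∀ n : ℕ, tvDist ((P ^ n) y) π ≤ M y * t ^ n

/-- `Y 0, Y 1, Y 2, …` is a time-homogeneous Markov chain with transition kernel `P`: given
`Y 0, …, Y n`, the conditional law of `Y (n + 1)` is `P (Y n, ·)`. -/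
structure IsMarkovChain {Ω S : Type*} [MeasurableSpace Ω] [MeasurableSpace S]
    (μ : Measure Ω) (P : Kernel S S) (Y : ℕ → Ω → S) : Prop where
  measurable : ∀ i, Measurable (Y i)
  map_history_next : ∀ n : ℕ,
    μ.map (fun ω => ((fun i : Finset.Iic n => Y i ω), Y (n + 1) ω)) =
      (μ.map fun ω => fun i : Finset.Iic n => Y i ω) ⊗ₘ
        (P.comap (fun y : Finset.Iic n → S => y ⟨n, Finset.mem_Iic.2 le_rfl⟩)
          (measurable_pi_apply _))

/-- The correlation of two real random variables; it is `0` if one of them is degenerate. -/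
def corr {Ω : Type*} [MeasurableSpace Ω] (μ : Measure Ω) (U V : Ω → ℝ) : ℝ :=
  cov[U, V; μ] / (√(Var[U; μ]) * √(Var[V; μ]))

/-- The integrated autocorrelation time of the kernel at the point `x`, for the bandwidth `h`:
`τ_n(K_{h,x}) = ∑_{|t| ≤ n - 1} (1 - |t| / n) corr(K_h(x - Y_1), K_h(x - Y_{t+1}))`,
where `Y i` is the variable `Y_{i+1}` of the formula. As usual for stationary sequences, the
correlation at a negative lag `t` is the one at lag `|t|`. -/
def kernelIACT {Ω : Type*} [MeasurableSpace Ω] (μ : Measure Ω) {S : Set ℝ} (Y : ℕ → Ω → S)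
    (K : ℝ → ℝ) (h x : ℝ) (n : ℕ) : ℝ :=
  ∑ t ∈ Finset.Ioo (-(n : ℤ)) (n : ℤ), (1 - |(t : ℝ)| / (n : ℝ)) *
    corr μ (fun ω => scaledKernel K h (x - (Y 0 ω : ℝ)))
      (fun ω => scaledKernel K h (x - (Y t.natAbs ω : ℝ)))

end

open Set

/-! Detailed balance makes `P` self-adjoint on L²(π), where π = f(dy). With P^n acting on functions,
the lag-n autocovariance of g is c_n = Cov(g, P^n g), and Cauchy–Schwarz with self-adjointness gives
c_n² ≤ Var(g) Var(P^n g) = c_0 c_{2n}. Once c_n = O(t^n), with any constant, iterating along n, 2n,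
4n, … removes the constant: |c_n| ≤ c_0 t^n (`abs_le_mul_pow_of_sq_le`).

Geometric ergodicity supplies the crude O(t^n) for bounded g vanishing where M is large. Such g
approximate every square-integrable function, and the sharpened bound, being free of the constant,
passes to the limit (`IsGeometricallyErgodic.exists_abs_autocovariance_le`).

Hence |corr| ≤ t^n with the same t for all g, so for all bandwidths and all x, and the sum is at
most 2 / (1 - t). Only square-integrability depends on x; it is finiteness of the convolution of f
with K_h², true almost everywhere. -/

/-- Two probability measures whose values differ by at most `ε` on every measurable set have
integrals of a bounded function differing by at most `2 C ε`. -/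
lemma abs_integral_sub_integral_le {α : Type*} [MeasurableSpace α] {μ ν : Measure α}
    [IsProbabilityMeasure μ] [IsProbabilityMeasure ν] {ε C : ℝ}
    (hε : ∀ A, MeasurableSet A → |μ.real A - ν.real A| ≤ ε) {g : α → ℝ} (hg : Measurable g)
    (hC : ∀ x, |g x| ≤ C) :
    |∫ x, g x ∂μ - ∫ x, g x ∂ν| ≤ 2 * C * ε := by
  have h0 : 0 ≤ C := by
    obtain ⟨x⟩ : Nonempty α := nonempty_of_isProbabilityMeasure μ
    exact (abs_nonneg _).trans (hC x)
  -- Layer-cake formula for `g + C`, which takes values in `[0, 2 * C]`; the length of this interval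
  -- is the factor in the bound.
  have key : ∀ (ρ : Measure α) [IsProbabilityMeasure ρ],
      Integrable g ρ ∧ ∫ x, g x ∂ρ = (∫ s in (0:ℝ)..(2 * C), ρ.real {x | s ≤ g x + C}) - C := by
    intro ρ _
    have hi : Integrable g ρ := .of_bound hg.aestronglyMeasurable C (.of_forall hC)
    refine ⟨hi, ?_⟩
    have h1 : Integrable (fun x => g x + C) ρ := hi.add (integrable_const _)
    have h2 := h1.integral_eq_integral_Ioc_meas_le (M := 2 * C)
      (.of_forall fun x => by have := (abs_le.1 (hC x)).1; simp only [Pi.zero_apply]; linarith)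
      (.of_forall fun x => by have := (abs_le.1 (hC x)).2; simp only; linarith)
    rw [integral_add hi (integrable_const _)] at h2
    rw [intervalIntegral.integral_of_le (by positivity)]
    simp only [integral_const, probReal_univ, one_smul] at h2
    linarith
  have mono : ∀ (ρ : Measure α) [IsProbabilityMeasure ρ],
      IntervalIntegrable (fun s => ρ.real {x | s ≤ g x + C}) volume 0 (2 * C) := by
    intro ρ _
    refine Antitone.intervalIntegrable fun a b hab => ?_
    exact measureReal_mono fun x (hx : b ≤ _) => hab.trans hx
  rw [(key μ).2, (key ν).2, sub_sub_sub_cancel_right,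
    ← intervalIntegral.integral_sub (mono μ) (mono ν)]
  have := intervalIntegral.norm_integral_le_of_norm_le_const (a := 0) (b := 2 * C) (C := ε)
    (f := fun s => μ.real {x | s ≤ g x + C} - ν.real {x | s ≤ g x + C})
    (fun s _ => hε _ (measurableSet_le measurable_const (hg.add_const C)))
  rw [Real.norm_eq_abs] at this
  refine this.trans_eq ?_
  rw [sub_zero, abs_of_nonneg (by positivity)]; ring

lemma abs_measureReal_sub_le_tvDist {α : Type*} [MeasurableSpace α] (μ ν : Measure α)
    [IsProbabilityMeasure μ] [IsProbabilityMeasure ν] {A : Set α} (hA : MeasurableSet A) :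
    |μ.real A - ν.real A| ≤ tvDist μ ν := by
  refine le_ciSup (f := fun A : {A : Set α // MeasurableSet A} => |μ.real A.1 - ν.real A.1|)
    ⟨1, ?_⟩ ⟨A, hA⟩
  rintro _ ⟨B, rfl⟩
  have h1 : μ.real B.1 ≤ 1 := measureReal_le_one
  have h2 : ν.real B.1 ≤ 1 := measureReal_le_one
  have h3 : 0 ≤ μ.real B.1 := measureReal_nonneg
  have h4 : 0 ≤ ν.real B.1 := measureReal_nonneg
  exact abs_le.2 ⟨by linarith, by linarith⟩

/-- A sequence with `c n ^ 2 ≤ c₀ * c (2 * n)` that is `O(t ^ n)` is bounded by `c₀ * t ^ n`. -/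
lemma abs_le_mul_pow_of_sq_le {c : ℕ → ℝ} {c₀ C t : ℝ} (ht : 0 < t) (hc₀ : 0 ≤ c₀)
    (hsq : ∀ n, c n ^ 2 ≤ c₀ * c (2 * n)) (hC : ∀ n, |c n| ≤ C * t ^ n) (n : ℕ) :
    |c n| ≤ c₀ * t ^ n := by
  by_contra! hlt
  rcases hc₀.eq_or_lt with rfl | hpos
  · have := hsq n
    have h0 : c n = 0 := by nlinarith
    simp [h0] at hlt
  -- The excess ratio `r > 1` is at least squared each time the index doubles, while the crude bound
  -- caps every such ratio at `C / c₀`.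
  set r := |c n| / (c₀ * t ^ n) with hr
  have hr1 : 1 < r := (one_lt_div (by positivity)).2 hlt
  have key : ∀ k : ℕ, r ^ (2 ^ k) * (c₀ * t ^ (2 ^ k * n)) ≤ |c (2 ^ k * n)| := by
    intro k
    induction k with
    | zero => simp only [pow_zero, pow_one, one_mul]; rw [hr, div_mul_cancel₀ _ (by positivity)]
    | succ k ih =>
      have h1 := hsq (2 ^ k * n)
      rw [← mul_assoc, ← pow_succ'] at h1
      have h2 : (r ^ (2 ^ k) * (c₀ * t ^ (2 ^ k * n))) ^ 2 ≤ c₀ * |c (2 ^ (k + 1) * n)| := by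
        calc _ ≤ |c (2 ^ k * n)| ^ 2 := by gcongr
          _ = c (2 ^ k * n) ^ 2 := sq_abs _
          _ ≤ _ := h1.trans (by gcongr; exact le_abs_self _)
      refine le_of_mul_le_mul_left (le_trans (le_of_eq ?_) h2) hpos
      rw [pow_succ 2 k]; ring
  have hb : ∀ k : ℕ, r ^ (2 ^ k) ≤ C / c₀ := by
    intro k
    rw [le_div_iff₀ hpos]
    refine le_of_mul_le_mul_right (le_trans (le_of_eq ?_) ((key k).trans (hC _)))
      (pow_pos ht (2 ^ k * n))
    ring
  obtain ⟨m, hm⟩ := pow_unbounded_of_one_lt (C / c₀) hr1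
  exact absurd (hm.trans_le (pow_le_pow_right₀ hr1.le Nat.lt_two_pow_self.le)) (hb m).not_gt

lemma ProbabilityTheory.Kernel.Invariant.pow {α : Type*} [MeasurableSpace α] {P : Kernel α α}
    {π : Measure α} (h : P.Invariant π) (n : ℕ) : (P ^ n).Invariant π := by
  induction n with
  | zero => rw [pow_zero]; exact Measure.id_comp
  | succ n ih => rw [pow_succ]; exact ih.comp h

/-! ### Self-adjointness of the powers of a reversible kernel -/

section Kernel

variable {α : Type*} [MeasurableSpace α] {P : Kernel α α} [IsMarkovKernel P] {π : Measure α}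
  [IsProbabilityMeasure π]

instance ProbabilityTheory.Kernel.isMarkovKernel_pow (n : ℕ) : IsMarkovKernel (P ^ n) := by
  induction n with
  | zero => rw [pow_zero]; exact inferInstanceAs (IsMarkovKernel Kernel.id)
  | succ n ih => rw [pow_succ]; exact inferInstanceAs (IsMarkovKernel ((P ^ n) ∘ₖ P))

lemma measurable_integral_kernel {κ : Kernel α α} [IsMarkovKernel κ] {g : α → ℝ}
    (hg : Measurable g) : Measurable fun x => ∫ y, g y ∂κ x :=
  (hg.stronglyMeasurable.integral_kernel (κ := κ)).measurable

lemma abs_integral_kernel_le {κ : Kernel α α} [IsMarkovKernel κ] {g : α → ℝ} {C : ℝ}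
    (hC : ∀ x, |g x| ≤ C) (x : α) : |∫ y, g y ∂κ x| ≤ C := by
  simpa using norm_integral_le_of_norm_le_const (μ := κ x) (f := g) (.of_forall hC)

lemma integral_kernel_pow_add (m n : ℕ) {g : α → ℝ} (hg : Measurable g) {C : ℝ}
    (hC : ∀ x, |g x| ≤ C) (x : α) :
    ∫ y, g y ∂(P ^ (m + n)) x = ∫ y, ∫ z, g z ∂(P ^ m) y ∂(P ^ n) x := by
  rw [Kernel.pow_add, Kernel.integral_comp]
  exact .of_bound hg.aestronglyMeasurable C (.of_forall hC)

lemma integral_compProd_mul (κ : Kernel α α) [IsMarkovKernel κ] {u v : α → ℝ} (hu : Measurable u)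
    (hv : Measurable v) {C D : ℝ} (hC : ∀ x, |u x| ≤ C) (hD : ∀ x, |v x| ≤ D) :
    ∫ p, u p.1 * v p.2 ∂(π ⊗ₘ κ) = ∫ x, u x * ∫ y, v y ∂κ x ∂π := by
  rw [Measure.integral_compProd]
  · simp only [integral_const_mul]
  · refine .of_bound (by fun_prop) (C * D) (.of_forall fun p => ?_)
    rw [norm_mul]
    exact mul_le_mul (hC _) (hD _) (norm_nonneg _) ((abs_nonneg _).trans (hC p.1))

lemma ProbabilityTheory.Kernel.IsReversible.map_swap_compProd (h : P.IsReversible π) :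
    (π ⊗ₘ P).map Prod.swap = π ⊗ₘ P := by
  refine Measure.ext_prod fun {A B} hA hB => ?_
  rw [Measure.map_apply measurable_swap (hA.prod hB), Set.preimage_swap_prod,
    Measure.compProd_apply_prod hB hA, Measure.compProd_apply_prod hA hB, h hB hA]

/-- Both sides integrate a product against the joint law `π ⊗ₘ P`, which is invariant under swapping
coordinates. -/
lemma ProbabilityTheory.Kernel.IsReversible.integral_mul_comm (h : P.IsReversible π) {u v : α → ℝ}
    (hu : Measurable u) (hv : Measurable v) {C D : ℝ} (hC : ∀ x, |u x| ≤ C)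
    (hD : ∀ x, |v x| ≤ D) :
    ∫ x, u x * ∫ y, v y ∂P x ∂π = ∫ x, (∫ y, u y ∂P x) * v x ∂π := by
  rw [← integral_compProd_mul P hu hv hC hD]
  conv_lhs => rw [← map_swap_compProd h]
  rw [integral_map measurable_swap.aemeasurable (by fun_prop)]
  simp only [Prod.fst_swap, Prod.snd_swap, mul_comm (u _)]
  rw [integral_compProd_mul P hv hu hD hC]
  simp only [mul_comm (v _)]

lemma ProbabilityTheory.Kernel.IsReversible.integral_pow_mul_comm (h : P.IsReversible π) (n : ℕ) {u v : α → ℝ}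
    (hu : Measurable u) (hv : Measurable v) {C D : ℝ} (hC : ∀ x, |u x| ≤ C)
    (hD : ∀ x, |v x| ≤ D) :
    ∫ x, u x * ∫ y, v y ∂(P ^ n) x ∂π = ∫ x, (∫ y, u y ∂(P ^ n) x) * v x ∂π := by
  induction n generalizing u C with
  | zero =>
    have : ∀ (w : α → ℝ), Measurable w → ∀ x, ∫ y, w y ∂(P ^ 0) x = w x := by
      intro w hw x
      rw [pow_zero]
      change ∫ y, w y ∂(Kernel.id x) = w x
      rw [Kernel.id_apply, integral_dirac' _ _ hw.stronglyMeasurable]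
    simp only [this u hu, this v hv]
  | succ n ih =>
    -- Splitting as P^n(P u) and P(P^n v) lets one factor P move across to u, leaving the induction
    -- hypothesis for P u and v.
    have h1 := fun x => integral_kernel_pow_add (P := P) 1 n hu hC x
    have h2 := fun x => integral_kernel_pow_add (P := P) n 1 hv hD x
    simp only [pow_one] at h1 h2
    rw [add_comm 1 n] at h1
    simp only [h1, h2]
    rw [integral_mul_comm h hu (measurable_integral_kernel hv) hC (abs_integral_kernel_le hD),
      ih (measurable_integral_kernel hu) (abs_integral_kernel_le hC)]

end Kernel

/-! ### Geometric decay of autocovariances -/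

lemma covariance_sq_le {α : Type*} [MeasurableSpace α] {π : Measure α} [IsFiniteMeasure π]
    {U V : α → ℝ} (hU : MemLp U 2 π) (hV : MemLp V 2 π) :
    cov[U, V; π] ^ 2 ≤ Var[U; π] * Var[V; π] := by
  -- The quadratic is Var(U + sV), so its discriminant is nonpositive.
  have h : ∀ s : ℝ, 0 ≤ Var[V; π] * (s * s) + 2 * cov[U, V; π] * s + Var[U; π] := by
    intro s
    have h1 := variance_nonneg (U + s • V) π
    rw [variance_add hU (hV.const_smul s), variance_smul, covariance_smul_right] at h1
    linarith
  have := discrim_le_zero h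
  rw [discrim] at this
  linarith

section Kernel

variable {α : Type*} [MeasurableSpace α] {P : Kernel α α} [IsMarkovKernel P] {π : Measure α}
  [IsProbabilityMeasure π]

/-- If the autocovariances of a bounded function along a reversible stationary chain are
`O(t ^ n)`, they are bounded by `t ^ n` times the variance. -/
lemma ProbabilityTheory.Kernel.IsReversible.abs_autocovariance_le_of_bounded
    (h : P.IsReversible π) {g : α → ℝ} (hg : Measurable g) {C D t : ℝ} (ht : 0 < t)
    (hC : ∀ x, |g x| ≤ C)
    (hD : ∀ n : ℕ, ∀ᵐ x ∂π, |g x * (∫ y, g y ∂(P ^ n) x - ∫ y, g y ∂π)| ≤ D * t ^ n) (n : ℕ) :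
    |∫ p, g p.1 * g p.2 ∂(π ⊗ₘ (P ^ n)) - (∫ x, g x ∂π) ^ 2| ≤
      (∫ x, g x ^ 2 ∂π - (∫ x, g x ∂π) ^ 2) * t ^ n := by
  have hmem : ∀ {u : α → ℝ}, Measurable u → (∀ x, |u x| ≤ C) → MemLp u 2 π :=
    fun hu hb => .of_bound hu.aestronglyMeasurable C (.of_forall hb)
  have hgn : ∀ n : ℕ, MemLp (fun x => ∫ y, g y ∂(P ^ n) x) 2 π :=
    fun n => hmem (measurable_integral_kernel hg) (abs_integral_kernel_le hC)
  have hmean : ∀ n : ℕ, ∫ x, ∫ y, g y ∂(P ^ n) x ∂π = ∫ x, g x ∂π := by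
    intro n
    have h1 := Measure.integral_compProd (μ := π) (κ := P ^ n) (f := fun p => g p.2)
      (.of_bound (hg.comp measurable_snd).aestronglyMeasurable C (.of_forall fun p => hC p.2))
    rw [← h1, ← integral_map (f := g) measurable_snd.aemeasurable hg.aestronglyMeasurable,
      ← Measure.snd, Measure.snd_compProd]
    exact congrArg (fun ρ => ∫ x, g x ∂ρ) (h.invariant.pow n)
  have hvar : Var[g; π] = ∫ x, g x ^ 2 ∂π - (∫ x, g x ∂π) ^ 2 := variance_eq_sub (hmem hg hC)
  have hcov : ∀ n : ℕ, ∫ p, g p.1 * g p.2 ∂(π ⊗ₘ (P ^ n)) - (∫ x, g x ∂π) ^ 2 =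
      cov[g, fun x => ∫ y, g y ∂(P ^ n) x; π] := by
    intro n
    rw [covariance_eq_sub (hmem hg hC) (hgn n), hmean, integral_compProd_mul _ hg hg hC hC, sq]
    rfl
  rw [← hvar, hcov]
  refine abs_le_mul_pow_of_sq_le (c := fun n => cov[g, fun x => ∫ y, g y ∂(P ^ n) x; π]) (C := D)
    ht (variance_nonneg _ _) (fun n => ?_) (fun n => ?_) n
  · refine (covariance_sq_le (hmem hg hC) (hgn n)).trans_eq ?_
    congr 1
    rw [variance_eq_sub (hgn n), hmean, ← hcov, integral_compProd_mul _ hg hg hC hC]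
    congr 1
    -- Self-adjointness: ∫ g · P^n(P^n g) dπ = ∫ (P^n g)² dπ.
    simp only [two_mul, integral_kernel_pow_add n n hg hC]
    rw [h.integral_pow_mul_comm n hg (measurable_integral_kernel hg) hC
      (abs_integral_kernel_le hC)]
    simp only [Pi.pow_apply, sq]
  · have : cov[g, fun x => ∫ y, g y ∂(P ^ n) x; π] =
        ∫ x, g x * (∫ y, g y ∂(P ^ n) x - ∫ y, g y ∂π) ∂π := by
      rw [covariance_eq_sub (hmem hg hC) (hgn n), hmean]
      simp only [mul_sub]
      have h1 : Integrable (fun x => g x * ∫ y, g y ∂(P ^ n) x) π :=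
        (hmem hg hC).integrable_mul (hgn n)
      rw [integral_sub h1 (((hmem hg hC).integrable one_le_two).mul_const _), integral_mul_const]
      rfl
    simp only [this]
    simpa using norm_integral_le_of_norm_le_const (μ := π)
      (f := fun x => g x * (∫ y, g y ∂(P ^ n) x - ∫ y, g y ∂π)) (hD n)

/-- Along a stationary, reversible and geometrically ergodic chain the autocovariances of a
square-integrable function decay geometrically, relative to its variance. -/
lemma IsGeometricallyErgodic.exists_abs_autocovariance_le
    (hgeo : IsGeometricallyErgodic P π) (h : P.IsReversible π) :
    ∃ t : ℝ, 0 < t ∧ t < 1 ∧ ∀ (g : α → ℝ), Measurable g → MemLp g 2 π → ∀ n : ℕ,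
      |∫ p, g p.1 * g p.2 ∂(π ⊗ₘ (P ^ n)) - (∫ x, g x ∂π) ^ 2| ≤
        (∫ x, g x ^ 2 ∂π - (∫ x, g x ∂π) ^ 2) * t ^ n := by
  obtain ⟨M, t, ht0, ht1, hM⟩ := hgeo
  refine ⟨t, ht0, ht1, fun g hg hg2 n => ?_⟩
  -- These sets exhaust almost all of the space. Neither M nor the total variation distance is known
  -- to be measurable in y, so measurable hulls of `A m` are used below.
  set A : ℕ → Set α := fun m => {y | ∀ n : ℕ, tvDist ((P ^ n) y) π ≤ m * t ^ n} with hA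
  have hAe : ∀ᵐ y ∂π, ∀ᶠ m in atTop, y ∈ A m := by
    filter_upwards [hM] with y hy
    filter_upwards [eventually_ge_atTop ⌈M y⌉₊] with m hm n
    have : M y ≤ m := Nat.ceil_le.1 hm
    exact (hy n).trans (by gcongr)
  have hB : ∀ (m : ℕ) {u : α → ℝ} {C : ℝ}, Measurable u → (∀ x, |u x| ≤ C) → ∀ n : ℕ,
      ∀ᵐ y ∂π, y ∈ toMeasurable π (A m) →
        |∫ z, u z ∂(P ^ n) y - ∫ z, u z ∂π| ≤ 2 * C * (m * t ^ n) := by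
    intro m u C hu hC n
    set G : Set α := {y | |∫ z, u z ∂(P ^ n) y - ∫ z, u z ∂π| ≤ 2 * C * (m * t ^ n)}
    have hG : MeasurableSet G := measurableSet_le
      ((measurable_integral_kernel hu).sub_const _).abs measurable_const
    have hAG : A m ∩ Gᶜ = ∅ := by
      rw [← Set.sdiff_eq, sdiff_eq_empty]
      intro y hy
      exact abs_integral_sub_integral_le
        (fun B hB => (abs_measureReal_sub_le_tvDist _ _ hB).trans (hy n)) hu hC
    -- For fixed `u` and `n` the good set `G` is measurable and contains `A m`, so the hull of `A m`
    -- exceeds it only by a null set.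
    have h0 := Measure.measure_toMeasurable_inter (μ := π) hG.compl (measure_ne_top π (A m))
    rw [hAG, measure_empty] at h0
    filter_upwards [measure_eq_zero_iff_ae_notMem.1 h0] with y hy hyA
    by_contra hyG
    exact hy ⟨hyA, hyG⟩
  set E : ℕ → Set α := fun m => toMeasurable π (A m) ∩ {x | |g x| ≤ m} with hE
  set v : ℕ → α → ℝ := fun m => (E m).indicator g with hv
  have hEm : ∀ m, MeasurableSet (E m) := fun m =>
    (measurableSet_toMeasurable _ _).inter (measurableSet_le hg.abs measurable_const)
  have hvm : ∀ m, Measurable (v m) := fun m => hg.indicator (hEm m)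
  have hvb : ∀ m x, |v m x| ≤ m := by
    intro m x
    by_cases hx : x ∈ E m
    · simpa [hv, hx] using hx.2
    · simp [hv, hx]
  have hvg : ∀ m x, ‖v m x‖ ≤ ‖g x‖ := fun m x => norm_indicator_le_norm_self _ _
  have hve : ∀ᵐ x ∂π, ∀ᶠ m in atTop, v m x = g x := by
    filter_upwards [hAe] with x hx
    filter_upwards [hx, eventually_ge_atTop ⌈|g x|⌉₊] with m hm hm2
    exact indicator_of_mem (show x ∈ E m from ⟨subset_toMeasurable _ _ hm, Nat.ceil_le.1 hm2⟩) g
  -- The crude constant `D` grows with `m` but is absent from the conclusion, which is what allows m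
  -- → ∞.
  have main : ∀ m, |∫ p, v m p.1 * v m p.2 ∂(π ⊗ₘ (P ^ n)) - (∫ x, v m x ∂π) ^ 2| ≤
      (∫ x, v m x ^ 2 ∂π - (∫ x, v m x ∂π) ^ 2) * t ^ n := by
    intro m
    -- `D` combines `|v m| ≤ m` with the bound `2 * m * (m * t ^ k)` from `hB` on the hull; off `E
    -- m` the product vanishes.
    refine h.abs_autocovariance_le_of_bounded (D := m * (2 * m * m)) (hvm m) ht0 (hvb m)
      (fun k => ?_) n
    filter_upwards [hB m (hvm m) (hvb m) k] with x hx
    by_cases hxE : x ∈ E m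
    · rw [abs_mul]
      calc _ ≤ (m : ℝ) * (2 * m * (m * t ^ k)) := by
            gcongr
            exacts [hvb m x, hx hxE.1]
        _ = _ := by ring
    · have : v m x = 0 := indicator_of_notMem hxE _
      rw [this, zero_mul, abs_zero]
      positivity
  have hgi : Integrable g π := hg2.integrable one_le_two
  have hfst : MeasurePreserving Prod.fst (π ⊗ₘ (P ^ n)) π :=
    ⟨measurable_fst, Measure.fst_compProd π (P ^ n)⟩
  have hsnd : MeasurePreserving Prod.snd (π ⊗ₘ (P ^ n)) π :=
    ⟨measurable_snd, (Measure.snd_compProd π (P ^ n)).trans (h.invariant.pow n)⟩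
  have l1 : Tendsto (fun m => ∫ x, v m x ∂π) atTop (nhds (∫ x, g x ∂π)) := by
    refine tendsto_integral_of_dominated_convergence (fun x => ‖g x‖)
      (fun m => (hvm m).aestronglyMeasurable) hgi.norm (fun m => .of_forall (hvg m)) ?_
    filter_upwards [hve] with x hx
    exact tendsto_nhds_of_eventually_eq hx
  have l2 : Tendsto (fun m => ∫ x, v m x ^ 2 ∂π) atTop (nhds (∫ x, g x ^ 2 ∂π)) := by
    refine tendsto_integral_of_dominated_convergence (fun x => g x ^ 2)
      (fun m => ((hvm m).pow_const 2).aestronglyMeasurable) hg2.integrable_sq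
      (fun m => .of_forall fun x => ?_) ?_
    · rw [norm_pow, ← sq_abs (g x)]
      exact pow_le_pow_left₀ (norm_nonneg _) (hvg m x) 2
    filter_upwards [hve] with x hx
    exact tendsto_nhds_of_eventually_eq (hx.mono fun m hm => by rw [hm])
  have l3 : Tendsto (fun m => ∫ p, v m p.1 * v m p.2 ∂(π ⊗ₘ (P ^ n))) atTop
      (nhds (∫ p, g p.1 * g p.2 ∂(π ⊗ₘ (P ^ n)))) := by
    refine tendsto_integral_of_dominated_convergence (fun p => ‖g p.1 * g p.2‖)
      (fun m => (((hvm m).comp measurable_fst).mul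
        ((hvm m).comp measurable_snd)).aestronglyMeasurable)
      ((hg2.comp_measurePreserving hfst).integrable_mul
        (hg2.comp_measurePreserving hsnd)).norm
      (fun m => .of_forall fun p => ?_) ?_
    · rw [norm_mul, norm_mul]
      exact mul_le_mul (hvg m _) (hvg m _) (norm_nonneg _) (norm_nonneg _)
    filter_upwards [hfst.quasiMeasurePreserving.ae hve, hsnd.quasiMeasurePreserving.ae hve]
      with p h1 h2
    exact tendsto_nhds_of_eventually_eq ((h1.and h2).mono fun m hm => by rw [hm.1, hm.2])
  exact le_of_tendsto_of_tendsto' (l3.sub (l1.pow 2)).abs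
    ((l2.sub (l1.pow 2)).mul_const _) main

end Kernel

/-! ### From the kernel to the stationary chain -/

section Chain

variable {Ω α : Type*} [MeasurableSpace Ω] [MeasurableSpace α] {μ : Measure Ω}
  [IsProbabilityMeasure μ] {P : Kernel α α} [IsMarkovKernel P] {Y : ℕ → Ω → α}

/-- Reduces correlations along the chain to integrals against `π ⊗ₘ (P ^ n)`. The event on `Y 0` is
read off the history up to `n`, so the Markov property adds one factor `P`. -/
lemma IsMarkovChain.map_zero_prodMk (hY : IsMarkovChain μ P Y) (n : ℕ) :
    μ.map (fun ω => (Y 0 ω, Y n ω)) = (μ.map (Y 0)) ⊗ₘ (P ^ n) := by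
  have : IsProbabilityMeasure (μ.map (Y 0)) :=
    Measure.isProbabilityMeasure_map (hY.measurable 0).aemeasurable
  induction n with
  | zero =>
    rw [pow_zero]
    change _ = _ ⊗ₘ Kernel.id
    rw [Measure.compProd_id, Measure.map_map (by fun_prop) (hY.measurable 0)]
    rfl
  | succ n ih =>
    refine Measure.ext_prod fun {A B} hA hB => ?_
    set H : Ω → (Finset.Iic n → α) := fun ω i => Y i ω
    have hH : Measurable H := measurable_pi_lambda _ fun i => hY.measurable i
    have : IsProbabilityMeasure (μ.map H) := Measure.isProbabilityMeasure_map hH.aemeasurable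
    have hA' : MeasurableSet {x : Finset.Iic n → α | x ⟨0, Finset.mem_Iic.2 n.zero_le⟩ ∈ A} :=
      measurable_pi_apply _ hA
    have e1 : μ.map (fun ω => (Y 0 ω, Y (n + 1) ω)) (A ×ˢ B) =
        μ.map (fun ω => (H ω, Y (n + 1) ω))
          ({x | x ⟨0, Finset.mem_Iic.2 n.zero_le⟩ ∈ A} ×ˢ B) := by
      rw [Measure.map_apply ((hY.measurable 0).prodMk (hY.measurable _)) (hA.prod hB),
        Measure.map_apply (hH.prodMk (hY.measurable _)) (hA'.prod hB)]
      rfl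
    have hP : Measurable fun p : α × α => P p.2 B := (P.measurable_coe hB).comp measurable_snd
    have e2 : ∫⁻ ω in Y 0 ⁻¹' A, P (Y n ω) B ∂μ =
        ∫⁻ p in A ×ˢ univ, P p.2 B ∂(μ.map (fun ω => (Y 0 ω, Y n ω))) := by
      rw [setLIntegral_map (hA.prod .univ) hP
        ((hY.measurable 0).prodMk (hY.measurable _))]
      congr 2
      ext; simp
    rw [e1, hY.map_history_next n, Measure.compProd_apply_prod hA' hB,
      setLIntegral_map hA' (Kernel.measurable_coe _ hB) hH]
    change ∫⁻ ω in Y 0 ⁻¹' A, P (Y n ω) B ∂μ = _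
    rw [e2, ih, Measure.setLIntegral_compProd hP hA .univ,
      Measure.compProd_apply_prod hA hB]
    refine lintegral_congr fun x => ?_
    rw [Measure.restrict_univ, Kernel.pow_succ_apply_eq_lintegral _ _ _ hB]

end Chain

lemma Finset.sum_natAbs_Ioo_le {t : ℝ} (ht0 : 0 < t) (ht1 : t < 1) (n : ℕ) :
    ∑ k ∈ Finset.Ioo (-(n : ℤ)) (n : ℤ), t ^ k.natAbs ≤ 2 * (1 - t)⁻¹ := by
  have hs : ∀ m : ℕ, ∑ k ∈ Finset.range m, t ^ k ≤ (1 - t)⁻¹ := fun m => by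
    rw [← tsum_geometric_of_lt_one ht0.le ht1]
    exact (summable_geometric_of_lt_one ht0.le ht1).sum_le_tsum _ fun k _ => by positivity
  -- Lag 0 lies in both images and is counted twice, which only weakens the bound.
  have hsub : Finset.Ioo (-(n : ℤ)) (n : ℤ) ⊆
      (Finset.range n).image (fun k : ℕ => (k : ℤ)) ∪
        (Finset.range n).image (fun k : ℕ => -(k : ℤ)) := by
    intro k hk
    simp only [Finset.mem_Ioo, Finset.mem_union, Finset.mem_image, Finset.mem_range] at hk ⊢
    rcases le_total 0 k with h | h
    · exact .inl ⟨k.natAbs, by omega, by omega⟩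
    · exact .inr ⟨k.natAbs, by omega, by omega⟩
  refine (Finset.sum_le_sum_of_subset_of_nonneg hsub fun k _ _ => by positivity).trans ?_
  refine (Finset.sum_union_inter (f := fun k : ℤ => t ^ k.natAbs) ▸
    le_add_of_nonneg_right (Finset.sum_nonneg fun k _ => by positivity)).trans ?_
  rw [Finset.sum_image (by intro a _ b _ h; simpa using h),
    Finset.sum_image (by intro a _ b _ h; simpa using h)]
  simp only [Int.natAbs_neg, Int.natAbs_natCast]
  linarith [hs n]

section Chain

variable {Ω α : Type*} [MeasurableSpace Ω] [MeasurableSpace α] {μ : Measure Ω}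
  [IsProbabilityMeasure μ] {P : Kernel α α} [IsMarkovKernel P] {Y : ℕ → Ω → α} {π : Measure α}

lemma IsMarkovChain.measurePreserving (hY : IsMarkovChain μ P Y) (hstat : μ.map (Y 0) = π)
    (hP : P.Invariant π) (i : ℕ) : MeasurePreserving (Y i) μ π := by
  have : IsProbabilityMeasure π :=
    hstat ▸ Measure.isProbabilityMeasure_map (hY.measurable 0).aemeasurable
  refine ⟨hY.measurable i, ?_⟩
  have h1 := congrArg Measure.snd (hY.map_zero_prodMk i)
  rw [Measure.snd_map_prodMk (hY.measurable 0), Measure.snd_compProd, hstat] at h1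
  exact h1.trans (hP.pow i)

/-- The rate is chosen before `g`: the function of interest changes with the bandwidth. -/
lemma IsMarkovChain.exists_abs_corr_le (hY : IsMarkovChain μ P Y) (hstat : μ.map (Y 0) = π)
    (hgeo : IsGeometricallyErgodic P π) (hrev : P.IsReversible π) :
    ∃ t : ℝ, 0 < t ∧ t < 1 ∧ ∀ g : α → ℝ, Measurable g → MemLp g 2 π → ∀ i : ℕ,
      |corr μ (fun ω => g (Y 0 ω)) (fun ω => g (Y i ω))| ≤ t ^ i := by
  have : IsProbabilityMeasure π :=
    hstat ▸ Measure.isProbabilityMeasure_map (hY.measurable 0).aemeasurable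
  have hlaw := hY.measurePreserving hstat hrev.invariant
  obtain ⟨t, ht0, ht1, ht⟩ := hgeo.exists_abs_autocovariance_le hrev
  refine ⟨t, ht0, ht1, fun g hg hg2 i => ?_⟩
  have hmem : ∀ j, MemLp (fun ω => g (Y j ω)) 2 μ :=
    fun j => hg2.comp_measurePreserving (hlaw j)
  have hmean : ∀ j, ∫ ω, g (Y j ω) ∂μ = ∫ y, g y ∂π := fun j => by
    rw [← (hlaw j).map_eq, integral_map (hlaw j).measurable.aemeasurable hg.aestronglyMeasurable]
  have hvar : ∀ j, Var[fun ω => g (Y j ω); μ] = ∫ y, g y ^ 2 ∂π - (∫ y, g y ∂π) ^ 2 := fun j =>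
    ((hlaw j).variance_fun_comp hg.aemeasurable).trans (variance_eq_sub hg2)
  have hcov : cov[fun ω => g (Y 0 ω), fun ω => g (Y i ω); μ] =
      ∫ p, g p.1 * g p.2 ∂(π ⊗ₘ (P ^ i)) - (∫ y, g y ∂π) ^ 2 := by
    have hg12 : Measurable fun p : α × α => g p.1 * g p.2 :=
      (hg.comp measurable_fst).mul (hg.comp measurable_snd)
    rw [covariance_eq_sub (hmem 0) (hmem i), hmean, hmean, ← hstat, ← hY.map_zero_prodMk,
      integral_map ((hY.measurable 0).prodMk (hY.measurable i)).aemeasurable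
        hg12.aestronglyMeasurable, sq]
    rfl
  have hnn : 0 ≤ ∫ y, g y ^ 2 ∂π - (∫ y, g y ∂π) ^ 2 := hvar 0 ▸ variance_nonneg _ _
  rw [corr, hvar, hvar, Real.mul_self_sqrt hnn, hcov, abs_div, abs_of_nonneg hnn]
  -- This also covers zero variance, where the quotient is 0.
  exact div_le_of_le_mul₀ hnn (by positivity) ((ht g hg hg2 i).trans_eq (mul_comm _ _))

end Chain

/-! ### The smoothing kernel and the final bound -/

lemma IsSmoothingKernel.measurable_scaledKernel {K : ℝ → ℝ} (hK : IsSmoothingKernel K) (h : ℝ) :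
    Measurable (scaledKernel K h) :=
  (hK.measurable.comp (measurable_id.div_const h)).div_const h

lemma IsSmoothingKernel.integrable_scaledKernel_sq {K : ℝ → ℝ} (hK : IsSmoothingKernel K) {h : ℝ}
    (hh : h ≠ 0) : Integrable (fun u => scaledKernel K h u ^ 2) := by
  have := (hK.sq_integrable.comp_div hh).div_const (h ^ 2)
  simpa only [scaledKernel, div_pow] using this

/-- The second moment at `x` is the convolution of f with K_h² at `x`; both are integrable, so it
exists for almost every `x`. -/
lemma IsSmoothingKernel.ae_memLp_scaledKernel {K : ℝ → ℝ} (hK : IsSmoothingKernel K) {h : ℝ}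
    (hh : h ≠ 0) {S : Set ℝ} (hS : MeasurableSet S) {f : ℝ → ℝ} (hf : IsProbDensityOn S f) :
    ∀ᵐ x ∂(volume : Measure ℝ),
      MemLp (fun y : S => scaledKernel K h (x - y)) 2 (densityMeasure S f) := by
  filter_upwards [hf.integrable.ae_convolution_exists (ContinuousLinearMap.mul ℝ ℝ)
    (hK.integrable_scaledKernel_sq hh)] with x hx
  have hmeas : Measurable fun y : ℝ => scaledKernel K h (x - y) :=
    (hK.measurable_scaledKernel h).comp (measurable_const.sub measurable_id)
  refine (memLp_two_iff_integrable_sq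
    (hmeas.comp measurable_subtype_coe).aestronglyMeasurable).2 ?_
  have he : MeasurableEmbedding ((↑) : S → ℝ) := .subtype_coe hS
  change Integrable ((fun y : ℝ => scaledKernel K h (x - y) ^ 2) ∘ ((↑) : S → ℝ)) _
  rw [← he.integrable_map_iff, densityMeasure, he.map_comap]
  refine Integrable.restrict ?_
  rw [integrable_withDensity_iff hf.measurable.ennreal_ofReal (.of_forall fun _ => by simp)]
  refine hx.congr (.of_forall fun y => ?_)
  simp [ENNReal.toReal_ofReal (hf.nonneg y), mul_comm]

theorem theorem4
    {Ω : Type*} [MeasurableSpace Ω] (μ : Measure Ω) [IsProbabilityMeasure μ]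
    (S : Set ℝ) (hS : MeasurableSet S)
    (f : ℝ → ℝ) (hf : IsProbDensityOn S f)
    (P : Kernel S S) [IsMarkovKernel P]
    (hgeo : IsGeometricallyErgodic P (densityMeasure S f))
    (hrev : P.IsReversible (densityMeasure S f))
    (Y : ℕ → Ω → S) (hY : IsMarkovChain μ P Y)
    (hstat : μ.map (Y 0) = densityMeasure S f)
    (K : ℝ → ℝ) (hK : IsSmoothingKernel K)
    (h : ℕ → ℝ) (hh : ∀ n, 0 < h n) :
    ∀ᵐ x ∂(volume : Measure ℝ),
      (∀ n i : ℕ, MemLp (fun ω => scaledKernel K (h n) (x - (Y i ω : ℝ))) 2 μ) ∧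
      (fun n : ℕ => kernelIACT μ Y K (h n) x n) =O[atTop] (fun _ : ℕ => (1 : ℝ)) := by
  obtain ⟨t, ht0, ht1, ht⟩ := hY.exists_abs_corr_le hstat hgeo hrev
  have hlaw := hY.measurePreserving hstat hrev.invariant
  -- The exceptional null set depends on the bandwidth, but there are only countably many
  -- bandwidths.
  filter_upwards [ae_all_iff.2 fun n => hK.ae_memLp_scaledKernel (hh n).ne' hS hf] with x hx
  refine ⟨fun n i => (hx n).comp_measurePreserving (hlaw i),
    IsBigO.of_bound (2 * (1 - t)⁻¹) (.of_forall fun n => ?_)⟩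
  have hg : Measurable fun y : S => scaledKernel K (h n) (x - y) :=
    (hK.measurable_scaledKernel (h n)).comp (measurable_const.sub measurable_subtype_coe)
  rw [norm_one, mul_one, Real.norm_eq_abs, kernelIACT]
  refine (Finset.abs_sum_le_sum_abs _ _).trans
    ((Finset.sum_le_sum fun k hk => ?_).trans (Finset.sum_natAbs_Ioo_le ht0 ht1 n))
  rw [Finset.mem_Ioo] at hk
  have hkn : |(k : ℝ)| ≤ n := by
    rw [abs_le]
    exact ⟨by exact_mod_cast hk.1.le, by exact_mod_cast hk.2.le⟩
  have h1 : |(k : ℝ)| / n ≤ 1 := div_le_one_of_le₀ hkn n.cast_nonneg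
  have h2 : 0 ≤ |(k : ℝ)| / n := by positivity
  rw [abs_mul]
  calc _ ≤ 1 * t ^ k.natAbs := by
        gcongr
        · exact abs_le.2 ⟨by linarith, by linarith⟩
        · exact ht _ hg (hx n) _
    _ = _ := one_mul _
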